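/- Let $(M,g)$ be a two-dimensional Riemannian manifold (a smooth second countable Hausdorff surface without boundary, not necessarily connected or complete, with a Riemannian metric $g$ of class $C^2$), with Riemannian volume measure $dV_g$. Suppose that $(M,g)$ is an *MT-manifold*, that is, $$\sup\Big\{\int_M \big(e^{4\pi \varphi^2}-1\big)\,dV_g \;:\; \varphi\in C_0^\infty(M),\ \int_M|\nabla_g \varphi|^2\,dV_g\le 1\Big\}<\infty .$$ Let $H^1_0(M)$ be the completion of $C_0^\infty(M)$ (smooth functions with compact support) in the norm $\big(\int_M u^2\,dV_g+\int_M|\nabla_g u|^2\,dV_g\big)^{1/2}$, and write $\|\nabla_g u\|^2=\int_M|\nabla_g u|^2\,dV_g$. Then for every $\delta\in(0,1)$ there are constants $C(\delta)>0$ and $c(\delta)>0$, depending only on $(M,g)$ and $\delta$, such that for every $u\in H^1_0(M)$ $$\ln\int_M (e^u-1)^2\,dV_g\ \le\ \ln\int_M \big(e^{2u}-2u-1\big)\,dV_g\ \le\ C(\delta)+\frac{1}{4\pi\delta}\int_M|\nabla_g u|^2\,dV_g$$ (with the convention $\ln 0=-\infty$), and, in the stronger form, $$\int_M (e^u-1)^2\,dV_g\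 \le\ \int_M \big(e^{2u}-2u-1\big)\,dV_g\ \le\ c(\delta)\Big(e^{\frac{\|\nabla_g u\|^2}{2\pi\delta}}-\frac{\|\nabla_g u\|^2}{2\pi\delta}-1\Big)^{1/2}.$$ In particular, all these integrals are finite. -/

import Mathlib

open MeasureTheory Filter Bundle
open scoped Manifold ContDiff Topology

noncomputable section

namespace MoserTrudinger

/-- The Euclidean plane, on which surfaces are modelled. -/
abbrev Plane : Type := EuclideanSpace ℝ (Fin 2)

section Volume

variable {M : Type*} [TopologicalSpace M] [ChartedSpace Plane M]
  [RiemannianBundle (fun x : M => TangentSpace (𝓡 2) x)]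

/-- The coordinate vector field `∂ᵢ` of the preferred chart at `p`, at the point of `M` with
coordinates `y`: the image of the `i`-th standard basis vector under the differential of the
inverse chart. -/
def coordVec (p : M) (y : Plane) (i : Fin 2) :
    TangentSpace (𝓡 2) ((extChartAt (𝓡 2) p).symm y) :=
  mfderiv 𝓘(ℝ, Plane) (𝓡 2) (extChartAt (𝓡 2) p).symm y (EuclideanSpace.single i (1 : ℝ) : Plane)

/-- The matrix `g_{ij} = ⟨∂ᵢ, ∂ⱼ⟩_g` of the metric in the preferred chart at `p`. -/
def metricMatrix (p : M) (y : Plane) : Matrix (Fin 2) (Fin 2) ℝ :=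
  Matrix.of fun i j => inner ℝ (coordVec p y i) (coordVec p y j)

variable [MeasurableSpace M]

/-- The Riemannian area `√(det g_{ij}) dy¹ dy²` on the domain of the preferred chart at `p`,
as a measure on `M` (vanishing outside this domain). -/
def chartVolume (p : M) : Measure M :=
  Measure.map (extChartAt (𝓡 2) p).symm
    (((volume : Measure Plane).restrict (extChartAt (𝓡 2) p).target).withDensity
      fun y => ENNReal.ofReal (Real.sqrt (metricMatrix p y).det))

variable (M) in
/-- The Riemannian volume measure `dV_g`. By the change of variables formula the chart measures
agree on overlaps of chart domains, and (on a second countable surface) their supremum in the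
lattice of measures is the unique measure which restricts on each chart domain to the
area `√(det g_{ij}) dy¹ dy²` of that chart. -/
def riemannianVolume : Measure M := ⨆ p : M, chartVolume p

end Volume

section Gradient

variable {M : Type*} [TopologicalSpace M] [ChartedSpace Plane M]
  [RiemannianBundle (fun x : M => TangentSpace (𝓡 2) x)]

/-- The Riemannian gradient of `φ` at `x`: the vector `∇_g φ(x)` of `T_x M` with
`⟨∇_g φ(x), v⟩_g = dφ_x(v)` for all `v`. -/
def grad (φ : M → ℝ) (x : M) : TangentSpace (𝓡 2) x :=
  haveI : FiniteDimensional ℝ (TangentSpace (𝓡 2) x) :=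
    inferInstanceAs (FiniteDimensional ℝ Plane)
  haveI : CompleteSpace (TangentSpace (𝓡 2) x) := FiniteDimensional.complete ℝ _
  (InnerProductSpace.toDual ℝ (TangentSpace (𝓡 2) x)).symm (mvfderiv (𝓡 2) φ x)

theorem inner_grad (φ : M → ℝ) (x : M) (v : TangentSpace (𝓡 2) x) :
    inner ℝ (grad φ x) v = mvfderiv (𝓡 2) φ x v := by
  simp [grad]

end Gradient

/-- `φ ∈ C₀^∞(M)`: `φ` is smooth with compact support. -/
structure IsTest {M : Type*} [TopologicalSpace M] [ChartedSpace Plane M] (φ : M → ℝ) : Prop where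
  smooth : ContMDiff (𝓡 2) 𝓘(ℝ, ℝ) ∞ φ
  compact : HasCompactSupport φ

section Sobolev

variable {M : Type*} [TopologicalSpace M] [ChartedSpace Plane M] [IsManifold (𝓡 2) ∞ M]
  [RiemannianBundle (fun x : M => TangentSpace (𝓡 2) x)] [MeasurableSpace M]

/-- `X ∈ L²(TM)`: an almost everywhere measurable vector field with `∫ |X|_g² dV_g < ∞`. -/
structure IsL2VectorField (X : ∀ x : M, TangentSpace (𝓡 2) x) : Prop where
  aemeasurable : @AEMeasurable M (TangentBundle (𝓡 2) M) (borel _) _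
    (fun x => (⟨x, X x⟩ : TangentBundle (𝓡 2) M)) (riemannianVolume M)
  integrable : Integrable (fun x => ‖X x‖ ^ 2) (riemannianVolume M)

/-- `u ∈ H¹₀(M)` with gradient `∇_g u = X`. The space `H¹₀(M)` is the completion of `C₀^∞(M)` for
the norm `(∫ |u|² dV_g + ∫ |∇_g u|² dV_g)^{1/2}`, realized in `L²(M) × L²(TM)` as the closure of
the pairs `(φ, ∇_g φ)` with `φ ∈ C₀^∞(M)`. (The gradient is a closable operator, so that `X` is
determined almost everywhere by `u`.) -/
structure HasH10Grad (u : M → ℝ) (X : ∀ x : M, TangentSpace (𝓡 2) x) : Prop where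
  memLp : MemLp u 2 (riemannianVolume M)
  grad_L2 : IsL2VectorField X
  approx : ∃ φ : ℕ → M → ℝ, (∀ n, IsTest (φ n)) ∧
    Tendsto (fun n => ∫⁻ x, ‖φ n x - u x‖ₑ ^ 2 ∂(riemannianVolume M)) atTop (𝓝 0) ∧
    Tendsto (fun n => ∫⁻ x, ‖grad (φ n) x - X x‖ₑ ^ 2 ∂(riemannianVolume M)) atTop (𝓝 0)

end Sobolev

/-- `(M, g)` is an MT-manifold: the Moser–Trudinger inequality with the critical exponent `4π`
holds, i.e. the supremum of `∫ (e^{4πφ²} - 1) dV_g` over all `φ ∈ C₀^∞(M)` with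
`∫ |∇_g φ|² dV_g ≤ 1` is finite. -/
def IsMTManifold (M : Type*) [TopologicalSpace M] [ChartedSpace Plane M]
    [RiemannianBundle (fun x : M => TangentSpace (𝓡 2) x)] [MeasurableSpace M] : Prop :=
  (⨆ (φ : M → ℝ) (_ : IsTest φ) (_ : ∫⁻ x, ‖grad φ x‖ₑ ^ 2 ∂(riemannianVolume M) ≤ 1),
    ∫⁻ x, ENNReal.ofReal (Real.exp (4 * Real.pi * φ x ^ 2) - 1) ∂(riemannianVolume M)) < ⊤

end MoserTrudinger

end

namespace MoserTrudinger

open scoped ENNReal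

/-! Write `T s = e^s - s - 1`. Cauchy–Schwarz on the power series of `T` gives `T (x y) ≤ √(T x²)
√(T y²)`. Splitting `2t = (2t/r) r` with `r² = D/(2π)` turns the first factor into `√(T (2a))`,
where `a = 4π t²/D` is exactly the Moser–Trudinger exponent of `t/√D`; since `T (2a) ≤ 2 (e^a -
1)²`, this factor is integrable uniformly over test functions of energy at most `D`
(`IsTest.lintegral_expTail_le`). Fatou's lemma and `D ↓ ‖∇u‖²` extend the bound to `H¹₀`
(`HasH10Grad.lintegral_expTail_le`). This already covers `δ = 1`; smaller `δ` follows by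
monotonicity of `T`. -/

/-! ### Pointwise inequalities for the truncated exponential -/

/-- The exponential series without its terms of degree `0` and `1`. -/
noncomputable def expTail (x : ℝ) : ℝ := Real.exp x - x - 1

lemma expTail_nonneg (x : ℝ) : 0 ≤ expTail x := by
  have := Real.add_one_le_exp x
  unfold expTail
  linarith

lemma continuous_expTail : Continuous expTail := by
  unfold expTail
  fun_prop

lemma hasSum_expTail (x : ℝ) :
    HasSum (fun n : ℕ => x ^ (n + 2) / (n + 2).factorial) (expTail x) := by
  have h := NormedSpace.expSeries_div_hasSum_exp (𝔸 := ℝ) x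
  rw [← Real.exp_eq_exp_ℝ] at h
  have h2 := (hasSum_nat_add_iff' 2).2 h
  simp only [Finset.sum_range_succ, Finset.sum_range_zero] at h2
  convert! h2 using 1
  simp [expTail]
  ring

lemma expTail_le_expTail_abs (x : ℝ) : expTail x ≤ expTail |x| := by
  rcases le_total 0 x with hx | hx
  · rw [abs_of_nonneg hx]
  -- The difference of the two sides is `2 (sinh |x| - |x|)`.
  · have h := Real.self_le_sinh_iff.2 (neg_nonneg.2 hx)
    rw [Real.sinh_eq, neg_neg] at h
    rw [abs_of_nonpos hx]
    unfold expTail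
    linarith

lemma expTail_mono {x y : ℝ} (hx : 0 ≤ x) (hxy : x ≤ y) : expTail x ≤ expTail y :=
  hasSum_le (fun n => by gcongr) (hasSum_expTail x) (hasSum_expTail y)

/-- Cauchy–Schwarz in `ℓ²` for the sequences `x^k/√k!` and `y^k/√k!`, `k ≥ 2`. -/
lemma expTail_mul_le_of_nonneg {x y : ℝ} (hx : 0 ≤ x) (hy : 0 ≤ y) :
    expTail (x * y) ≤ Real.sqrt (expTail (x ^ 2)) * Real.sqrt (expTail (y ^ 2)) := by
  have key : ∀ z : ℝ, HasSum (fun n : ℕ => (z ^ (n + 2) / Real.sqrt (n + 2).factorial) ^ (2 : ℝ))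
      (Real.sqrt (expTail (z ^ 2)) ^ (2 : ℝ)) := by
    intro z
    rw [Real.rpow_two, Real.sq_sqrt (expTail_nonneg _)]
    convert! hasSum_expTail (z ^ 2) using 1
    ext n
    rw [Real.rpow_two, div_pow, Real.sq_sqrt (by positivity), ← pow_mul, ← pow_mul, mul_comm 2]
  obtain ⟨C, -, hC, hs⟩ := Real.inner_le_Lp_mul_Lq_hasSum_of_nonneg
    Real.HolderConjugate.two_two (Real.sqrt_nonneg _) (Real.sqrt_nonneg _)
    (fun n => by positivity) (fun n => by positivity) (key x) (key y)
  have : C = expTail (x * y) := by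
    refine hs.unique ?_
    convert! hasSum_expTail (x * y) using 1
    ext n
    rw [div_mul_div_comm, Real.mul_self_sqrt (by positivity), mul_pow]
  rwa [← this]

lemma expTail_mul_le (x y : ℝ) :
    expTail (x * y) ≤ Real.sqrt (expTail (x ^ 2)) * Real.sqrt (expTail (y ^ 2)) := by
  refine (expTail_le_expTail_abs _).trans ?_
  rw [abs_mul, ← sq_abs x, ← sq_abs y]
  exact expTail_mul_le_of_nonneg (abs_nonneg x) (abs_nonneg y)

/-- Right side minus left side is `e^{2a} - 4e^a + 2a + 3`, which vanishes at `0` and has derivative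
`2 (e^a - 1)²`. -/
lemma expTail_two_mul_le {a : ℝ} (ha : 0 ≤ a) :
    expTail (2 * a) ≤ 2 * (Real.exp a - 1) ^ 2 := by
  have h : ∀ x : ℝ, HasDerivAt (fun x => Real.exp x ^ 2 - 4 * Real.exp x + 2 * x)
      (2 * (Real.exp x - 1) ^ 2) x := by
    intro x
    convert! (((Real.hasDerivAt_exp x).pow 2).sub ((Real.hasDerivAt_exp x).const_mul 4)).add
      ((hasDerivAt_id x).const_mul 2) using 1
    simp
    ring
  have hm : Monotone (fun x => Real.exp x ^ 2 - 4 * Real.exp x + 2 * x) :=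
    monotone_of_hasDerivAt_nonneg h (fun x => by positivity)
  have h0 := hm ha
  simp only [Real.exp_zero] at h0
  have h2 : Real.exp (2 * a) = Real.exp a ^ 2 := by rw [← Real.exp_nat_mul]; simp
  unfold expTail
  rw [h2]
  nlinarith

/-- Pointwise form of the passage from the Moser–Trudinger integrand to the exponential one. -/
lemma expTail_two_mul_le_exp_sq {D : ℝ} (hD : 0 < D) (t : ℝ) :
    expTail (2 * t) ≤ Real.sqrt 2 * Real.sqrt (expTail (D / (2 * Real.pi))) *
      (Real.exp (4 * Real.pi * ((Real.sqrt D)⁻¹ * t) ^ 2) - 1) := by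
  have hπ := Real.pi_pos
  set a := 4 * Real.pi * ((Real.sqrt D)⁻¹ * t) ^ 2 with ha
  have ha0 : 0 ≤ a := by positivity
  have h1 : Real.sqrt (expTail (2 * a)) ≤ Real.sqrt 2 * (Real.exp a - 1) := by
    refine (Real.sqrt_le_sqrt (expTail_two_mul_le ha0)).trans_eq ?_
    rw [Real.sqrt_mul (by norm_num), Real.sqrt_sq (by linarith [Real.add_one_le_exp a])]
  -- This value of `r` makes `(2t/r)² = 2a`.
  set r := Real.sqrt (D / (2 * Real.pi)) with hr
  have hr0 : r ≠ 0 := by positivity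
  have hr2 : r ^ 2 = D / (2 * Real.pi) := Real.sq_sqrt (by positivity)
  have h2 : (2 * t / r) ^ 2 = 2 * a := by
    rw [div_pow, hr2, ha, mul_pow (Real.sqrt D)⁻¹ t, inv_pow, Real.sq_sqrt hD.le]
    field_simp
    ring
  have h3 := expTail_mul_le (2 * t / r) r
  rw [div_mul_cancel₀ _ hr0, h2, hr2] at h3
  calc expTail (2 * t) ≤ _ := h3
    _ ≤ Real.sqrt 2 * (Real.exp a - 1) * Real.sqrt (expTail (D / (2 * Real.pi))) := by gcongr
    _ = _ := by ring

lemma sq_exp_sub_one_le_expTail (t : ℝ) : (Real.exp t - 1) ^ 2 ≤ expTail (2 * t) := by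
  have h2 : Real.exp (2 * t) = Real.exp t ^ 2 := by rw [← Real.exp_nat_mul]; simp
  have := Real.add_one_le_exp t
  unfold expTail
  rw [h2]
  nlinarith

lemma sqrt_expTail_le {s : ℝ} (hs : 0 ≤ s) : Real.sqrt (expTail s) ≤ Real.exp (s / 2) := by
  rw [← Real.sqrt_sq (Real.exp_pos (s / 2)).le]
  refine Real.sqrt_le_sqrt ?_
  rw [← Real.exp_nat_mul]
  unfold expTail
  push_cast
  rw [mul_div_cancel₀ _ (two_ne_zero)]
  linarith

/-- Triangle inequality and Young's inequality with weight `ε`. -/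
lemma enorm_sq_le_add_sub {E : Type*} [NormedAddCommGroup E] (a b : E) {ε : ℝ} (hε : 0 < ε) :
    ‖a‖ₑ ^ 2 ≤ ENNReal.ofReal (1 + ε) * ‖b‖ₑ ^ 2 + ENNReal.ofReal (1 + ε⁻¹) * ‖a - b‖ₑ ^ 2 := by
  simp only [← ofReal_norm, ← ENNReal.ofReal_pow (norm_nonneg _)]
  rw [← ENNReal.ofReal_mul (by positivity), ← ENNReal.ofReal_mul (by positivity),
    ← ENNReal.ofReal_add (by positivity) (by positivity)]
  refine ENNReal.ofReal_le_ofReal ?_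
  have h1 : ‖a‖ ≤ ‖b‖ + ‖a - b‖ := by
    simpa using norm_add_le b (a - b)
  have h2 : (1 + ε) * ‖b‖ ^ 2 + (1 + ε⁻¹) * ‖a - b‖ ^ 2 =
      (‖b‖ + ‖a - b‖) ^ 2 + ε⁻¹ * (ε * ‖b‖ - ‖a - b‖) ^ 2 := by
    field_simp
    ring
  rw [h2]
  have h3 : ‖a‖ ^ 2 ≤ (‖b‖ + ‖a - b‖) ^ 2 := by gcongr
  have : 0 ≤ ε⁻¹ * (ε * ‖b‖ - ‖a - b‖) ^ 2 := by positivity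
  linarith

/-! ### From test functions to `H¹₀` -/

section Manifold

variable {M : Type*} [TopologicalSpace M] [ChartedSpace Plane M]

lemma IsTest.const_mul {φ : M → ℝ} (hφ : IsTest φ) (c : ℝ) : IsTest (fun x => c * φ x) :=
  ⟨contMDiff_const.mul hφ.smooth, hφ.compact.mul_left⟩

variable [RiemannianBundle (fun x : M => TangentSpace (𝓡 2) x)]

lemma grad_const_mul {φ : M → ℝ} (hφ : IsTest φ) (c : ℝ) (x : M) :
    grad (fun x => c * φ x) x = c • grad φ x := by
  have hd : MDifferentiableAt (𝓡 2) 𝓘(ℝ, ℝ) φ x := hφ.smooth.mdifferentiableAt (by simp)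
  refine ext_inner_right ℝ fun v => ?_
  rw [inner_smul_left, inner_grad, inner_grad]
  have h := mvfderiv_fun_mul (I := 𝓡 2) (mdifferentiableAt_const (c := c) (x := x)) hd
  have h0 : mvfderiv (𝓡 2) (fun _ : M => c) x = 0 := by
    simp [mvfderiv, mfderiv_const]
  simp [h, h0]

variable [MeasurableSpace M]

lemma IsTest.lintegral_expTail_le {K : ℝ}
    (hMT : ∀ ψ : M → ℝ, IsTest ψ → ∫⁻ x, ‖grad ψ x‖ₑ ^ 2 ∂(riemannianVolume M) ≤ 1 →
      ∫⁻ x, ENNReal.ofReal (Real.exp (4 * Real.pi * ψ x ^ 2) - 1) ∂(riemannianVolume M) ≤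
        ENNReal.ofReal K)
    {φ : M → ℝ} (hφ : IsTest φ) {D : ℝ} (hD : 0 < D)
    (hφD : ∫⁻ x, ‖grad φ x‖ₑ ^ 2 ∂(riemannianVolume M) ≤ ENNReal.ofReal D) :
    ∫⁻ x, ENNReal.ofReal (expTail (2 * φ x)) ∂(riemannianVolume M) ≤
      ENNReal.ofReal (Real.sqrt 2 * K * Real.sqrt (expTail (D / (2 * Real.pi)))) := by
  have hE : ∫⁻ x, ‖grad (fun x => (Real.sqrt D)⁻¹ * φ x) x‖ₑ ^ 2 ∂(riemannianVolume M) ≤ 1 := by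
    calc ∫⁻ x, ‖grad (fun x => (Real.sqrt D)⁻¹ * φ x) x‖ₑ ^ 2 ∂(riemannianVolume M)
        = ∫⁻ x, ENNReal.ofReal D⁻¹ * ‖grad φ x‖ₑ ^ 2 ∂(riemannianVolume M) := by
          refine lintegral_congr fun x => ?_
          rw [grad_const_mul hφ, enorm_smul, mul_pow, ← ofReal_norm (Real.sqrt D)⁻¹,
            ← ENNReal.ofReal_pow (norm_nonneg _), Real.norm_eq_abs, sq_abs, inv_pow,
            Real.sq_sqrt hD.le]
      _ = ENNReal.ofReal D⁻¹ * ∫⁻ x, ‖grad φ x‖ₑ ^ 2 ∂(riemannianVolume M) :=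
          lintegral_const_mul' _ _ ENNReal.ofReal_ne_top
      _ ≤ ENNReal.ofReal D⁻¹ * ENNReal.ofReal D := by gcongr
      _ = 1 := by
          rw [← ENNReal.ofReal_mul (by positivity), inv_mul_cancel₀ hD.ne', ENNReal.ofReal_one]
  set S := Real.sqrt 2 * Real.sqrt (expTail (D / (2 * Real.pi))) with hS
  have hS0 : 0 ≤ S := by positivity
  calc ∫⁻ x, ENNReal.ofReal (expTail (2 * φ x)) ∂(riemannianVolume M)
      ≤ ∫⁻ x, ENNReal.ofReal S *
          ENNReal.ofReal (Real.exp (4 * Real.pi * ((Real.sqrt D)⁻¹ * φ x) ^ 2) - 1)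
          ∂(riemannianVolume M) := by
        refine lintegral_mono fun x => ?_
        rw [← ENNReal.ofReal_mul hS0]
        exact ENNReal.ofReal_le_ofReal (expTail_two_mul_le_exp_sq hD (φ x))
    _ = ENNReal.ofReal S * ∫⁻ x,
          ENNReal.ofReal (Real.exp (4 * Real.pi * ((Real.sqrt D)⁻¹ * φ x) ^ 2) - 1)
          ∂(riemannianVolume M) := lintegral_const_mul' _ _ ENNReal.ofReal_ne_top
    _ ≤ ENNReal.ofReal S * ENNReal.ofReal K := by
        gcongr
        exact hMT _ (hφ.const_mul _) hE
    _ = _ := by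
        rw [← ENNReal.ofReal_mul hS0, hS]
        congr 1
        ring

lemma eventually_energy_le {X : ∀ x : M, TangentSpace (𝓡 2) x}
    (hX : Integrable (fun x => ‖X x‖ ^ 2) (riemannianVolume M)) {φ : ℕ → M → ℝ}
    (h : Tendsto (fun n => ∫⁻ x, ‖grad (φ n) x - X x‖ₑ ^ 2 ∂(riemannianVolume M)) atTop (𝓝 0))
    {D : ℝ} (hD : ∫ x, ‖X x‖ ^ 2 ∂(riemannianVolume M) < D) :
    ∀ᶠ n in atTop, ∫⁻ x, ‖grad (φ n) x‖ₑ ^ 2 ∂(riemannianVolume M) ≤ ENNReal.ofReal D := by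
  set A := ∫ x, ‖X x‖ ^ 2 ∂(riemannianVolume M) with hA
  have hA0 : 0 ≤ A := integral_nonneg fun x => by positivity
  have henorm : ∀ x, ‖X x‖ₑ ^ 2 = ENNReal.ofReal (‖X x‖ ^ 2) := fun x => by
    rw [← ofReal_norm, ENNReal.ofReal_pow (norm_nonneg _)]
  have hXA : ∫⁻ x, ‖X x‖ₑ ^ 2 ∂(riemannianVolume M) = ENNReal.ofReal A := by
    rw [hA, ofReal_integral_eq_lintegral_ofReal hX (ae_of_all _ fun x => by positivity)]
    exact lintegral_congr henorm
  have hmeas : AEMeasurable (fun x => ‖X x‖ₑ ^ 2) (riemannianVolume M) := by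
    simp only [henorm]
    exact hX.aemeasurable.ennreal_ofReal
  -- The `+ 1` in the witness keeps the denominator nonzero when `A = 0`.
  obtain ⟨ε, hε, hεD⟩ : ∃ ε : ℝ, 0 < ε ∧ (1 + ε) * A < D := by
    refine ⟨(D - A) / (2 * (A + 1)), by have := sub_pos.2 hD; positivity, ?_⟩
    have : (D - A) / (2 * (A + 1)) * A ≤ (D - A) / 2 := by
      rw [div_mul_eq_mul_div, div_le_div_iff₀ (by positivity) (by norm_num)]
      nlinarith
    nlinarith
  -- Splitting off the term in `X` requires measurability of that term only, not of `grad (φ n)`.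
  have hbound : ∀ n, ∫⁻ x, ‖grad (φ n) x‖ₑ ^ 2 ∂(riemannianVolume M) ≤
      ENNReal.ofReal ((1 + ε) * A) + ENNReal.ofReal (1 + ε⁻¹) *
        ∫⁻ x, ‖grad (φ n) x - X x‖ₑ ^ 2 ∂(riemannianVolume M) := by
    intro n
    rw [ENNReal.ofReal_mul (by positivity), ← hXA,
      ← lintegral_const_mul' _ _ ENNReal.ofReal_ne_top,
      ← lintegral_const_mul' _ _ ENNReal.ofReal_ne_top,
      ← lintegral_add_left' (hmeas.const_mul _)]
    exact lintegral_mono fun x => enorm_sq_le_add_sub _ _ hε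
  have hlim : Tendsto (fun n => ENNReal.ofReal ((1 + ε) * A) + ENNReal.ofReal (1 + ε⁻¹) *
      ∫⁻ x, ‖grad (φ n) x - X x‖ₑ ^ 2 ∂(riemannianVolume M)) atTop
      (𝓝 (ENNReal.ofReal ((1 + ε) * A))) := by
    simpa using (ENNReal.Tendsto.const_mul h (Or.inr ENNReal.ofReal_ne_top)).const_add
      (ENNReal.ofReal ((1 + ε) * A))
  have hlt : ENNReal.ofReal ((1 + ε) * A) < ENNReal.ofReal D :=
    (ENNReal.ofReal_lt_ofReal_iff (hA0.trans_lt hD)).2 hεD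
  filter_upwards [hlim.eventually_lt_const hlt] with n hn
  exact (hbound n).trans hn.le

variable [IsManifold (𝓡 2) ∞ M] [BorelSpace M]

/-- The exponential inequality on `H¹₀(M)` with the sharp constant. -/
lemma HasH10Grad.lintegral_expTail_le {K : ℝ}
    (hMT : ∀ ψ : M → ℝ, IsTest ψ → ∫⁻ x, ‖grad ψ x‖ₑ ^ 2 ∂(riemannianVolume M) ≤ 1 →
      ∫⁻ x, ENNReal.ofReal (Real.exp (4 * Real.pi * ψ x ^ 2) - 1) ∂(riemannianVolume M) ≤
        ENNReal.ofReal K)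
    {u : M → ℝ} {X : ∀ x : M, TangentSpace (𝓡 2) x} (hu : HasH10Grad u X) :
    ∫⁻ x, ENNReal.ofReal (expTail (2 * u x)) ∂(riemannianVolume M) ≤
      ENNReal.ofReal (Real.sqrt 2 * K *
        Real.sqrt (expTail ((∫ x, ‖X x‖ ^ 2 ∂(riemannianVolume M)) / (2 * Real.pi)))) := by
  obtain ⟨φ, hφ, hφu, hφX⟩ := hu.approx
  have hcont : ∀ n, Continuous (φ n) := fun n => (hφ n).smooth.continuous
  have hL2 : Tendsto (fun n => eLpNorm (φ n - u) 2 (riemannianVolume M)) atTop (𝓝 0) := by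
    have h := hφu.ennrpow_const (1 / 2 : ℝ)
    rw [ENNReal.zero_rpow_of_pos (by norm_num)] at h
    refine h.congr fun n => ?_
    rw [eLpNorm_eq_lintegral_rpow_enorm_toReal (by norm_num) (by norm_num)]
    simp
  obtain ⟨ns, hns, hae⟩ := (tendstoInMeasure_of_tendsto_eLpNorm (by norm_num)
    (fun n => (hcont n).measurable.aestronglyMeasurable) hu.memLp.1 hL2).exists_seq_tendsto_ae
  -- A strict `D` gives the approximants room to have energy at most `D` eventually, and it is
  -- positive even if `X = 0`.
  have hlim : ∀ D : ℝ, ∫ x, ‖X x‖ ^ 2 ∂(riemannianVolume M) < D →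
      ∫⁻ x, ENNReal.ofReal (expTail (2 * u x)) ∂(riemannianVolume M) ≤
        ENNReal.ofReal (Real.sqrt 2 * K * Real.sqrt (expTail (D / (2 * Real.pi)))) := by
    intro D hD
    have hD0 : 0 < D := (integral_nonneg fun x => by positivity).trans_lt hD
    calc ∫⁻ x, ENNReal.ofReal (expTail (2 * u x)) ∂(riemannianVolume M)
        = ∫⁻ x, liminf (fun i => ENNReal.ofReal (expTail (2 * φ (ns i) x))) atTop
            ∂(riemannianVolume M) := by
          refine lintegral_congr_ae ?_
          filter_upwards [hae] with x hx
          have hc : Continuous fun t : ℝ => ENNReal.ofReal (expTail (2 * t)) :=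
            ENNReal.continuous_ofReal.comp (continuous_expTail.comp (by fun_prop))
          exact (((hc.tendsto (u x)).comp hx).liminf_eq).symm
      _ ≤ liminf (fun i => ∫⁻ x, ENNReal.ofReal (expTail (2 * φ (ns i) x))
            ∂(riemannianVolume M)) atTop := by
          refine lintegral_liminf_le fun i => ?_
          exact (ENNReal.continuous_ofReal.comp (continuous_expTail.comp
            ((hcont (ns i)).const_mul 2))).measurable
      _ ≤ _ := by
          refine liminf_le_of_frequently_le' (Eventually.frequently ?_)
          filter_upwards [hns.tendsto_atTop.eventually
            (eventually_energy_le hu.grad_L2.integrable hφX hD)] with i hi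
          exact (hφ (ns i)).lintegral_expTail_le hMT hD0 hi
  have hc : Continuous fun D : ℝ =>
      ENNReal.ofReal (Real.sqrt 2 * K * Real.sqrt (expTail (D / (2 * Real.pi)))) :=
    ENNReal.continuous_ofReal.comp (continuous_const.mul
      (Real.continuous_sqrt.comp (continuous_expTail.comp (by fun_prop))))
  refine ge_of_tendsto (hc.continuousWithinAt
    (s := Set.Ioi (∫ x, ‖X x‖ ^ 2 ∂(riemannianVolume M)))) ?_
  filter_upwards [self_mem_nhdsWithin] with D hD
  exact hlim D hD

end Manifold

end MoserTrudinger

open MoserTrudinger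

/-- Integrals of nonnegative functions are taken with values in `[0, ∞]`, and `ENNReal.log` is the
logarithm `[0, ∞] → [-∞, ∞]`, with `ln 0 = -∞` and `ln ∞ = ∞`. -/
theorem corollary2p2 (M : Type*) [TopologicalSpace M] [T2Space M] [SecondCountableTopology M]
    [ChartedSpace MoserTrudinger.Plane M] [IsManifold (𝓡 2) ∞ M]
    [RiemannianBundle (fun x : M => TangentSpace (𝓡 2) x)]
    [IsContMDiffRiemannianBundle (𝓡 2) 2 MoserTrudinger.Plane
      (fun x : M => TangentSpace (𝓡 2) x)]
    [MeasurableSpace M] [BorelSpace M]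
    (hM : MoserTrudinger.IsMTManifold M) (δ : ℝ) (hδ0 : 0 < δ) (hδ1 : δ < 1) :
    (∃ C : ℝ, 0 < C ∧
      ∀ (u : M → ℝ) (X : ∀ x : M, TangentSpace (𝓡 2) x), MoserTrudinger.HasH10Grad u X →
        ENNReal.log (∫⁻ x, ENNReal.ofReal ((Real.exp (u x) - 1) ^ 2)
            ∂(MoserTrudinger.riemannianVolume M)) ≤
          ENNReal.log (∫⁻ x, ENNReal.ofReal (Real.exp (2 * u x) - 2 * u x - 1)
            ∂(MoserTrudinger.riemannianVolume M)) ∧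
        ENNReal.log (∫⁻ x, ENNReal.ofReal (Real.exp (2 * u x) - 2 * u x - 1)
            ∂(MoserTrudinger.riemannianVolume M)) ≤
          ((C + 1 / (4 * δ * Real.pi) *
            ∫ x, ‖X x‖ ^ 2 ∂(MoserTrudinger.riemannianVolume M) : ℝ) : EReal)) ∧
    (∃ c : ℝ, 0 < c ∧
      ∀ (u : M → ℝ) (X : ∀ x : M, TangentSpace (𝓡 2) x), MoserTrudinger.HasH10Grad u X →
        ∫⁻ x, ENNReal.ofReal ((Real.exp (u x) - 1) ^ 2)
            ∂(MoserTrudinger.riemannianVolume M) ≤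
          ∫⁻ x, ENNReal.ofReal (Real.exp (2 * u x) - 2 * u x - 1)
            ∂(MoserTrudinger.riemannianVolume M) ∧
        ∫⁻ x, ENNReal.ofReal (Real.exp (2 * u x) - 2 * u x - 1)
            ∂(MoserTrudinger.riemannianVolume M) ≤
          ENNReal.ofReal (c * Real.sqrt
            (Real.exp ((∫ x, ‖X x‖ ^ 2 ∂(MoserTrudinger.riemannianVolume M)) /
                (2 * Real.pi * δ)) -
              (∫ x, ‖X x‖ ^ 2 ∂(MoserTrudinger.riemannianVolume M)) / (2 * Real.pi * δ) - 1))) := by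
  set S : ENNReal := ⨆ (φ : M → ℝ) (_ : IsTest φ)
    (_ : ∫⁻ x, ‖grad φ x‖ₑ ^ 2 ∂(riemannianVolume M) ≤ 1),
    ∫⁻ x, ENNReal.ofReal (Real.exp (4 * Real.pi * φ x ^ 2) - 1) ∂(riemannianVolume M) with hS
  have hStop : S < ⊤ := hM
  have hMT : ∀ ψ : M → ℝ, IsTest ψ → ∫⁻ x, ‖grad ψ x‖ₑ ^ 2 ∂(riemannianVolume M) ≤ 1 →
      ∫⁻ x, ENNReal.ofReal (Real.exp (4 * Real.pi * ψ x ^ 2) - 1) ∂(riemannianVolume M) ≤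
        ENNReal.ofReal S.toReal := by
    intro ψ hψ hE
    rw [ENNReal.ofReal_toReal hStop.ne]
    exact le_iSup_of_le ψ (le_iSup_of_le hψ (le_iSup_of_le hE le_rfl))
  -- The `+ 1` keeps `c` positive even if the supremum is `0`.
  set c : ℝ := Real.sqrt 2 * S.toReal + 1 with hc
  have hc0 : 0 < c := by positivity
  have lower : ∀ u : M → ℝ, ∫⁻ x, ENNReal.ofReal ((Real.exp (u x) - 1) ^ 2)
      ∂(riemannianVolume M) ≤ ∫⁻ x, ENNReal.ofReal (Real.exp (2 * u x) - 2 * u x - 1)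
      ∂(riemannianVolume M) := fun u =>
    lintegral_mono fun x => ENNReal.ofReal_le_ofReal (sq_exp_sub_one_le_expTail (u x))
  have upper : ∀ (u : M → ℝ) (X : ∀ x : M, TangentSpace (𝓡 2) x), HasH10Grad u X →
      ∫⁻ x, ENNReal.ofReal (Real.exp (2 * u x) - 2 * u x - 1) ∂(riemannianVolume M) ≤
        ENNReal.ofReal (c * Real.sqrt (expTail
          ((∫ x, ‖X x‖ ^ 2 ∂(riemannianVolume M)) / (2 * Real.pi * δ)))) := by
    intro u X hu
    refine (hu.lintegral_expTail_le hMT).trans (ENNReal.ofReal_le_ofReal ?_)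
    have hA : 0 ≤ ∫ x, ‖X x‖ ^ 2 ∂(riemannianVolume M) := integral_nonneg fun x => by positivity
    have hπ := Real.pi_pos
    gcongr
    · linarith
    · refine expTail_mono (by positivity) ?_
      exact div_le_div_of_nonneg_left hA (by positivity)
        (mul_le_of_le_one_right (by positivity) hδ1.le)
  refine ⟨⟨c, hc0, fun u X hu => ⟨ENNReal.log_monotone (lower u), ?_⟩⟩,
    c, hc0, fun u X hu => ⟨lower u, upper u X hu⟩⟩
  have hA : 0 ≤ ∫ x, ‖X x‖ ^ 2 ∂(riemannianVolume M) := integral_nonneg fun x => by positivity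
  have hπ := Real.pi_pos
  set A := ∫ x, ‖X x‖ ^ 2 ∂(riemannianVolume M) with hAdef
  -- The logarithmic form can take `C = c`, because `c ≤ e^c` and `√(T s) ≤ e^{s/2}`.
  have hle : c * Real.sqrt (expTail (A / (2 * Real.pi * δ))) ≤
      Real.exp (c + 1 / (4 * δ * Real.pi) * A) := by
    rw [Real.exp_add]
    have h1 : c ≤ Real.exp c := by linarith [Real.add_one_le_exp c]
    have h2 := sqrt_expTail_le (s := A / (2 * Real.pi * δ)) (by positivity)
    have h3 : A / (2 * Real.pi * δ) / 2 = 1 / (4 * δ * Real.pi) * A := by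
      field_simp
      ring
    rw [h3] at h2
    gcongr
  refine (ENNReal.log_monotone ((upper u X hu).trans (ENNReal.ofReal_le_ofReal hle))).trans_eq ?_
  rw [← EReal.exp_coe, EReal.log_exp]
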